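/- Let $\mathcal C$ be a triangulated category, $K(\mathcal C)$ its Grothendieck group, and $q\colon K(\mathcal C)\twoheadrightarrow A$ a surjective homomorphism onto a finitely generated abelian group. A stability condition $\sigma=(Z_\sigma,\mathcal P_\sigma)$ on $\mathcal C$ is a homomorphism $Z_\sigma\colon K(\mathcal C)\to\mathbb C$ with strict full additive subcategories $\mathcal P_\sigma(\varphi)$, $\varphi\in\mathbb R$, such that: (1) if $0\ne c\in\mathcal P_\sigma(\varphi)$ then $Z_\sigma(c)=m(c)e^{i\pi\varphi}$ with $m(c)>0$; (2) $\mathcal P_\sigma(\varphi+1)=\mathcal P_\sigma(\varphi)[1]$; (3) $\mathrm{Hom}(c,c')=0$ if $c\in\mathcal P_\sigma(\varphi)$, $c'\in\mathcal P_\sigma(\varphi')$ and $\varphi>\varphi'$; (4) every nonzero object $c$ has a Harder–Narasimhan filtration, that is, a finite sequence $0=c_0\to c_1\to\cdots\to c_n=c$ with exact triangles $c_{j-1}\to c_j\to b_j\to c_{j-1}[1]$ in which $0\neq b_j\in\mathcal P_\sigma(\varphi_j)$ and $\varphi_1>\cdots>\varphi_n$. Put $\varphi^+_\sigma(c)=\varphi_1$,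 $\varphi^-_\sigma(c)=\varphi_n$ and $m_\sigma(c)=\sum_j m(b_j)$. For $I\subset\mathbb R$ let $\mathcal P_\sigma(I)$ be the ext-closed subcategory generated by the $\mathcal P_\sigma(\varphi)$, $\varphi\in I$. Call $\sigma$ locally-finite if for every $t\in\mathbb R$ there is $0<\epsilon<1/2$ such that the quasi-abelian category $\mathcal P_\sigma((t-\epsilon,t+\epsilon))$ is artinian and noetherian (with respect to strict subobjects). Stability conditions carry the generalised metric $$d(\sigma,\tau)=\sup_{0\ne c\in\mathcal C}\max\Big\{|\varphi^-_\sigma(c)-\varphi^-_\tau(c)|,\ |\varphi^+_\sigma(c)-\varphi^+_\tau(c)|,\ \Big|\log\frac{m_\sigma(c)}{m_\tau(c)}\Big|\Big\}\in[0,\infty]$$ and its topology. Let $\mathrm{Stab}^0$ be a connected component of the space of locally-finite stability conditions whose central charge factors through $q$, and suppose that it is full, i.e. that the projection $\mathrm{Stab}^0\to\mathrm{Hom}(A,\mathbb C)$ given by the central charge is a local homeomorphism. Let $(\sigma_n)$ be a sequence in $\mathrm{Stab}^0$ that is Cauchy for $d$. For $\theta\in\mathbb R$ let $\mathcal P(\theta)$,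 the category of limiting semistable objects of phase $\theta$, be the ext-closed subcategory of $\mathcal C$ generated by the nonzero objects $c$ with $\varphi^+_{\sigma_n}(c)\to\theta$ and $\varphi^-_{\sigma_n}(c)\to\theta$ as $n\to\infty$ (together with the zero objects). Then every nonzero object $c$ of $\mathcal C$ has a filtration by limiting semistable objects: there are a finite sequence $0=c_0\to c_1\to\cdots\to c_r=c$, exact triangles $c_{i-1}\to c_i\to b_i\to c_{i-1}[1]$ and real numbers $\theta_1>\cdots>\theta_r$ such that $0\neq b_i\in\mathcal P(\theta_i)$ for $i=1,\dots,r$. -/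

import Mathlib

open CategoryTheory CategoryTheory.Limits CategoryTheory.Pretriangulated Filter Topology
open scoped ENNReal

namespace StabCond

universe v u

section

variable (C : Type u) [Category.{v} C] [Preadditive C] [HasZeroObject C] [HasShift C ℤ]
  [∀ n : ℤ, (shiftFunctor C n).Additive] [Pretriangulated C]

/-- The relations `[b] = [a] + [c]`, one for every exact triangle `a → b → c → a[1]`. -/
def triangleRelations : Set (FreeAbelianGroup C) :=
  {x | ∃ T ∈ distTriang C, x = FreeAbelianGroup.of T.obj₂
    - (FreeAbelianGroup.of T.obj₁ + FreeAbelianGroup.of T.obj₃)}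

/-- The Grothendieck group `K(C)` of a triangulated category. -/
abbrev K : Type u := FreeAbelianGroup C ⧸ AddSubgroup.closure (triangleRelations C)

variable {C}

/-- The class `[c]` of an object in the Grothendieck group. -/
def cls (c : C) : K C := QuotientAddGroup.mk (FreeAbelianGroup.of c)

/-- A finite filtration `0 = c₀ → c₁ → ⋯ → c_n = c` by exact triangles
`c_i → c_{i+1} → b_i → c_i[1]` whose factors `b_i` are nonzero objects of `P (θ_i)`, with
strictly decreasing phases `θ_i`. -/
structure HNFiltration (P : ℝ → ObjectProperty C) (c : C) where
  /-- the number of factors -/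
  n : ℕ
  /-- the filtration objects -/
  obj : Fin (n + 1) → C
  /-- the maps of the filtration -/
  map : ∀ i : Fin n, obj i.castSucc ⟶ obj i.succ
  /-- the factors -/
  factor : Fin n → C
  /-- the projections to the factors -/
  proj : ∀ i : Fin n, obj i.succ ⟶ factor i
  /-- the connecting (dotted) maps -/
  conn : ∀ i : Fin n, factor i ⟶ (obj i.castSucc)⟦(1 : ℤ)⟧
  triangle : ∀ i : Fin n, Triangle.mk (map i) (proj i) (conn i) ∈ distTriang C
  isZero_bot : IsZero (obj 0)
  /-- the last object is `c` -/
  topIso : obj (Fin.last n) ≅ c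
  /-- the phases of the factors -/
  phase : Fin n → ℝ
  phase_strictAnti : StrictAnti phase
  factor_mem : ∀ i, P (phase i) (factor i)
  factor_nonzero : ∀ i, ¬ IsZero (factor i)

lemma HNFiltration.n_pos {P : ℝ → ObjectProperty C} {c : C} (F : HNFiltration P c)
    (hc : ¬ IsZero c) : 0 < F.n := by
  obtain ⟨n, obj, _, _, _, _, _, h0, e, _, _, _, _⟩ := F
  rcases Nat.eq_zero_or_pos n with rfl | h
  · exact absurd (h0.of_iso e.symm) hc
  · exact h

variable (C) in
/-- A (Bridgeland) stability condition: a central charge `Z` and full additive strict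
subcategories `P φ` (containing the zero objects, as additive subcategories do). -/
structure StabilityCondition where
  /-- the central charge -/
  Z : K C →+ ℂ
  /-- the semistable objects of each phase (and the zero objects) -/
  P : ℝ → ObjectProperty C
  mem_of_iso : ∀ (φ : ℝ) (a b : C), (a ≅ b) → P φ a → P φ b
  mem_of_isZero : ∀ (φ : ℝ) (a : C), IsZero a → P φ a
  mem_biprod : ∀ (φ : ℝ) (a b : C), P φ a → P φ b → P φ (a ⊞ b)
  charge : ∀ (φ : ℝ) (c : C), P φ c → ¬ IsZero c →
    ∃ m : ℝ, 0 < m ∧ Z (cls c) = m * Complex.exp (Complex.I * Real.pi * φ)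
  shift_iff : ∀ (φ : ℝ) (c : C), P (φ + 1) (c⟦(1 : ℤ)⟧) ↔ P φ c
  hom_eq_zero : ∀ (φ φ' : ℝ) (c c' : C), φ' < φ → P φ c → P φ' c' → ∀ f : c ⟶ c', f = 0
  hn_exists : ∀ c : C, ¬ IsZero c → Nonempty (HNFiltration P c)

namespace StabilityCondition

/-- The Harder--Narasimhan filtration of a nonzero object (it is unique up to isomorphism). -/
noncomputable def hn (σ : StabilityCondition C) (c : C) (hc : ¬ IsZero c) :
    HNFiltration σ.P c := (σ.hn_exists c hc).some

/-- `φ⁺_σ(c)`, the phase of the first Harder--Narasimhan factor. -/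
noncomputable def phiPlus (σ : StabilityCondition C) (c : C) (hc : ¬ IsZero c) : ℝ :=
  (σ.hn c hc).phase ⟨0, (σ.hn c hc).n_pos hc⟩

/-- `φ⁻_σ(c)`, the phase of the last Harder--Narasimhan factor. -/
noncomputable def phiMinus (σ : StabilityCondition C) (c : C) (hc : ¬ IsZero c) : ℝ :=
  (σ.hn c hc).phase ⟨(σ.hn c hc).n - 1, Nat.sub_one_lt_of_lt ((σ.hn c hc).n_pos hc)⟩

/-- The mass `m_σ(c) = ∑ m(b_i)`; by the axiom `charge`, `m(b) = |Z(b)|` for `b` semistable. -/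
noncomputable def mass (σ : StabilityCondition C) (c : C) (hc : ¬ IsZero c) : ℝ :=
  ∑ i, ‖σ.Z (cls ((σ.hn c hc).factor i))‖

lemma mass_pos (σ : StabilityCondition C) (c : C) (hc : ¬ IsZero c) : 0 < σ.mass c hc := by
  have hpos : ∀ i, 0 < ‖σ.Z (cls ((σ.hn c hc).factor i))‖ := by
    intro i
    obtain ⟨m, hm, h⟩ := σ.charge _ _ ((σ.hn c hc).factor_mem i) ((σ.hn c hc).factor_nonzero i)
    rw [h, norm_pos_iff]
    exact mul_ne_zero (by exact_mod_cast hm.ne') (Complex.exp_ne_zero _)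
  exact Finset.sum_pos (fun i _ => hpos i) ⟨⟨0, (σ.hn c hc).n_pos hc⟩, Finset.mem_univ _⟩

/-- The term of the nonzero object `c` in the supremum that defines the distance. -/
noncomputable def distAt (σ τ : StabilityCondition C) (c : C) (hc : ¬ IsZero c) : ℝ :=
  max (max |σ.phiMinus c hc - τ.phiMinus c hc| |σ.phiPlus c hc - τ.phiPlus c hc|)
    |Real.log (σ.mass c hc / τ.mass c hc)|

lemma distAt_self (σ : StabilityCondition C) (c : C) (hc : ¬ IsZero c) :
    distAt σ σ c hc = 0 := by
  simp [distAt, (σ.mass_pos c hc).ne']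

lemma distAt_comm (σ τ : StabilityCondition C) (c : C) (hc : ¬ IsZero c) :
    distAt σ τ c hc = distAt τ σ c hc := by
  unfold distAt
  rw [Real.log_div (σ.mass_pos c hc).ne' (τ.mass_pos c hc).ne',
    Real.log_div (τ.mass_pos c hc).ne' (σ.mass_pos c hc).ne',
    abs_sub_comm (σ.phiMinus c hc), abs_sub_comm (σ.phiPlus c hc),
    abs_sub_comm (Real.log (σ.mass c hc))]

lemma distAt_triangle (σ τ ρ : StabilityCondition C) (c : C) (hc : ¬ IsZero c) :
    distAt σ ρ c hc ≤ distAt σ τ c hc + distAt τ ρ c hc := by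
  unfold distAt
  rw [Real.log_div (σ.mass_pos c hc).ne' (τ.mass_pos c hc).ne',
    Real.log_div (τ.mass_pos c hc).ne' (ρ.mass_pos c hc).ne',
    Real.log_div (σ.mass_pos c hc).ne' (ρ.mass_pos c hc).ne']
  refine max_le (max_le ?_ ?_) ?_
  · exact (abs_sub_le _ (τ.phiMinus c hc) _).trans
      (add_le_add ((le_max_left _ _).trans (le_max_left _ _))
        ((le_max_left _ _).trans (le_max_left _ _)))
  · exact (abs_sub_le _ (τ.phiPlus c hc) _).trans
      (add_le_add ((le_max_right _ _).trans (le_max_left _ _))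
        ((le_max_right _ _).trans (le_max_left _ _)))
  · exact (abs_sub_le _ (Real.log (τ.mass c hc)) _).trans
      (add_le_add (le_max_right _ _) (le_max_right _ _))

/-- The generalised metric on stability conditions, with values in `[0, ∞]`. It gives the
topology, the uniform structure and the notion of Cauchy sequence. -/
noncomputable instance : PseudoEMetricSpace (StabilityCondition C) where
  edist σ τ := ⨆ (c : C) (hc : ¬ IsZero c), ENNReal.ofReal (distAt σ τ c hc)
  edist_self σ := by simp [distAt_self]
  edist_comm σ τ := by simp only [distAt_comm σ τ]
  edist_triangle σ τ ρ := by
    refine iSup₂_le fun c hc => ?_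
    refine (ENNReal.ofReal_le_ofReal (distAt_triangle σ τ ρ c hc)).trans
      (ENNReal.ofReal_add_le.trans (add_le_add ?_ ?_))
    · exact le_iSup₂ (f := fun c hc => ENNReal.ofReal (distAt σ τ c hc)) c hc
    · exact le_iSup₂ (f := fun c hc => ENNReal.ofReal (distAt τ ρ c hc)) c hc

end StabilityCondition

/-- The objects of the ext-closed (full, strict) subcategory generated by `S`, with the zero
objects. Closure under isomorphism follows from the triangles `a → b → 0 → a[1]`. -/
inductive ExtClosure (S : ObjectProperty C) : ObjectProperty C
  | of (c : C) : S c → ExtClosure S c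
  | zero (c : C) : IsZero c → ExtClosure S c
  | ext (T : Triangle C) : T ∈ distTriang C → ExtClosure S T.obj₁ → ExtClosure S T.obj₃ →
      ExtClosure S T.obj₂

/-- `P_σ(I)`, generated by the semistable objects with phase in `I`. -/
def StabilityCondition.interval (σ : StabilityCondition C) (I : Set ℝ) : ObjectProperty C :=
  ExtClosure fun c => ∃ φ ∈ I, σ.P φ c

/-- The ordered set of strict subobjects of an object `E`: those given by a monomorphism which
is a kernel. -/
abbrev StrictSubobject {D : Type*} [Category D] [HasZeroMorphisms D] (E : D) :=
  {S : Subobject E // Nonempty (NormalMono S.arrow)}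

/-- Noetherian: every ascending chain of strict subobjects of an object stabilises. -/
def IsNoetherianCat (D : Type*) [Category D] [HasZeroMorphisms D] : Prop :=
  ∀ E : D, WellFoundedGT (StrictSubobject E)

/-- Artinian: every descending chain of strict subobjects of an object stabilises. -/
def IsArtinianCat (D : Type*) [Category D] [HasZeroMorphisms D] : Prop :=
  ∀ E : D, WellFoundedLT (StrictSubobject E)

/-- Local finiteness. The intervals have length `2 * ε < 1`, so that the subcategories
`P_σ(t - ε, t + ε)` are quasi-abelian. -/
def StabilityCondition.IsLocallyFinite (σ : StabilityCondition C) : Prop :=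
  ∀ t : ℝ, ∃ ε : ℝ, 0 < ε ∧ ε < 1 / 2 ∧
    IsArtinianCat (σ.interval (Set.Ioo (t - ε) (t + ε))).FullSubcategory ∧
    IsNoetherianCat (σ.interval (Set.Ioo (t - ε) (t + ε))).FullSubcategory

/-- `Hom(A, ℂ)` with the topology of pointwise convergence. For finitely generated `A` this is
the usual topology of the finite-dimensional complex vector space `Hom(A, ℂ)`. -/
noncomputable abbrev homTopology (A : Type*) [AddCommGroup A] : TopologicalSpace (A →+ ℂ) :=
  TopologicalSpace.induced (fun (W : A →+ ℂ) (a : A) => W a) inferInstance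

/-- The set of locally-finite stability conditions whose central charge factors through
`q : K(C) → A`. -/
def stab {A : Type*} [AddCommGroup A] (q : K C →+ A) : Set (StabilityCondition C) :=
  {σ | σ.IsLocallyFinite ∧ ∃ W : A →+ ℂ, σ.Z = W.comp q}

/-- `U` is a connected component of `stab q`, and it is full: the projection `U → Hom(A, ℂ)`,
which takes `σ` to the map through which its central charge factors, is a local
homeomorphism. -/
def IsFullComponent {A : Type*} [AddCommGroup A] (q : K C →+ A)
    (U : Set (StabilityCondition C)) : Prop :=
  (∃ σ₀ ∈ stab q, U = connectedComponentIn (stab q) σ₀) ∧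
    ∃ π : U → (A →+ ℂ), (∀ σ : U, σ.1.Z = (π σ).comp q) ∧
      @IsLocalHomeomorph U (A →+ ℂ) inferInstance (homTopology A) π

/-- The limiting semistable objects `P(θ)` of phase `θ` of a sequence `σ_n`: the ext-closed
subcategory generated by the nonzero `c` with `φ⁺_n(c) → θ` and `φ⁻_n(c) → θ`. -/
def limitingSemistable (σ : ℕ → StabilityCondition C) (θ : ℝ) : ObjectProperty C :=
  ExtClosure fun c => ∃ hc : ¬ IsZero c,
    Tendsto (fun n => (σ n).phiPlus c hc) atTop (𝓝 θ) ∧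
    Tendsto (fun n => (σ n).phiMinus c hc) atTop (𝓝 θ)

end

end StabCond

namespace StabCond

/-! ### Classes in the Grothendieck group -/

section Triangulated

variable {C : Type*} [Category C] [Preadditive C] [HasZeroObject C] [HasShift C ℤ]
  [∀ n : ℤ, (shiftFunctor C n).Additive] [Pretriangulated C]

/-! For large `n`, the Harder–Narasimhan filtration of `c` for `σ n` is already a filtration by
limiting semistable objects, up to merging neighbouring factors whose limit phases agree. The point
is that limit phases of objects of bounded mass are uniformly separated.

Fullness lets the central charge be perturbed slightly in every direction, which bounds every
homomorphism `A →+ ℂ` by the mass (`exists_norm_le_mass`). Since `A` is finitely generated, objects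
of bounded mass have finitely many classes (`finite_boundedClasses`), so the limits of their central
charges have finitely many directions (`exists_finite_directions`), and distinct limit phases differ
by at least some `δ` (`exists_phase_gap`). If `n` is so large that later phases move by less than `δ
/ 4`, the limits of `φ⁺` and `φ⁻` of a factor must coincide, and limit phases cannot reverse the
order of the factors. `HNFiltration.regroup` then merges equal phases by the octahedral axiom. -/

lemma cls_triangle {T : Triangle C} (hT : T ∈ distTriang C) :
    cls T.obj₂ = cls T.obj₁ + cls T.obj₃ := by
  have h : (QuotientAddGroup.mk (FreeAbelianGroup.of T.obj₂
      - (FreeAbelianGroup.of T.obj₁ + FreeAbelianGroup.of T.obj₃)) : K C) = 0 :=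
    (QuotientAddGroup.eq_zero_iff _).2 (AddSubgroup.subset_closure ⟨T, hT, rfl⟩)
  exact sub_eq_zero.1 h

lemma cls_isZero {c : C} (hc : IsZero c) : cls c = 0 := by
  have hT : Triangle.mk (𝟙 c) (0 : c ⟶ c) 0 ∈ distTriang C :=
    isomorphic_distinguished _ (contractible_distinguished c) _
      (Triangle.isoMk _ _ (Iso.refl _) (Iso.refl _) (hc.iso (isZero_zero C)) rfl
        ((isZero_zero C).eq_of_tgt _ _) (hc.eq_of_src _ _))
  simpa using cls_triangle hT

lemma cls_iso {a b : C} (e : a ≅ b) : cls a = cls b := by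
  obtain ⟨z, g, w, hT⟩ := distinguished_cocone_triangle e.hom
  have hz : IsZero z := (Triangle.isZero₃_iff_isIso₁ _ hT).2 (inferInstanceAs (IsIso e.hom))
  have h := cls_triangle hT
  simp only [Triangle.mk_obj₁, Triangle.mk_obj₂, Triangle.mk_obj₃] at h
  rw [h, cls_isZero hz, add_zero]

namespace HNFiltration

variable {P : ℝ → ObjectProperty C} {c : C}

lemma cls_obj (F : HNFiltration P c) (k : Fin (F.n + 1)) :
    cls (F.obj k) = ∑ i : Fin F.n, if i.castSucc < k then cls (F.factor i) else 0 := by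
  induction k using Fin.induction with
  | zero => simp [cls_isZero F.isZero_bot]
  | succ j ih =>
    have h := cls_triangle (F.triangle j)
    simp only [Triangle.mk_obj₁, Triangle.mk_obj₂, Triangle.mk_obj₃] at h
    rw [h, ih, ← Fintype.sum_ite_eq' j (fun i => cls (F.factor i)), ← Finset.sum_add_distrib]
    refine Finset.sum_congr rfl fun i _ => ?_
    rcases lt_trichotomy i j with hij | rfl | hij
    · have : i.castSucc < j.succ := by simp only [Fin.lt_def] at hij ⊢; simp; omega
      simp [this, hij, hij.ne]
    · simp
    · have : ¬ i.castSucc < j.succ := by simp only [Fin.lt_def] at hij ⊢; simp; omega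
      simp [this, hij.not_gt, hij.ne']

lemma cls_eq_sum (F : HNFiltration P c) : cls c = ∑ i, cls (F.factor i) := by
  rw [← cls_iso F.topIso, F.cls_obj]
  simp [Fin.castSucc_lt_last]

end HNFiltration

/-! ### Phases and masses of semistable objects -/

namespace StabilityCondition

variable (σ : StabilityCondition C)

lemma P_shift_neg {φ : ℝ} {c : C} (h : σ.P φ c) : σ.P (φ - 1) (c⟦(-1 : ℤ)⟧) := by
  refine (σ.shift_iff _ _).1 ?_
  rw [sub_add_cancel]
  exact σ.mem_of_iso _ _ _ (shiftNegShift c (1 : ℤ)).symm h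

/-- Morphisms from an object of phase `φ` into `F_k` vanish when they vanish into `c`, provided
all the phases of the factors are below `φ + 1`. -/
lemma hom_obj_eq_zero {c : C} (F : HNFiltration σ.P c) {φ : ℝ} {x : C} (hx : σ.P φ x)
    (hF : ∀ i, F.phase i - 1 < φ) (h0 : ∀ f : x ⟶ c, f = 0) (k : Fin (F.n + 1)) :
    ∀ f : x ⟶ F.obj k, f = 0 := by
  induction k using Fin.reverseInduction with
  | last =>
    intro f
    have h := h0 (f ≫ F.topIso.hom)
    rwa [← cancel_mono F.topIso.hom, zero_comp]
  | cast i ih =>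
    intro f
    -- A map into `F_i` that dies in `F_{i+1}` comes from `b_i[-1]`, whose phase is below `φ`.
    obtain ⟨g, hg⟩ := Triangle.coyoneda_exact₂ _ (inv_rot_of_distTriang _ (F.triangle i)) f
      (ih _)
    have := σ.hom_eq_zero _ _ _ _ (hF i) hx (σ.P_shift_neg (F.factor_mem i)) g
    exact hg.trans ((congrArg (· ≫ _) this).trans zero_comp)

/-- Morphisms from `F_k` to an object whose phase is below the phases of the first `k` factors
vanish. -/
lemma obj_hom_eq_zero {c : C} (F : HNFiltration σ.P c) {φ : ℝ} {y : C} (hy : σ.P φ y)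
    (k : Fin (F.n + 1)) (hF : ∀ i : Fin F.n, i.castSucc < k → φ < F.phase i) :
    ∀ f : F.obj k ⟶ y, f = 0 := by
  induction k using Fin.induction with
  | zero => exact fun f => F.isZero_bot.eq_of_src _ _
  | succ j ih =>
    intro f
    have h0 : F.map j ≫ f = 0 :=
      ih (fun i hi => hF i (hi.trans (by simp [Fin.lt_def]))) _
    obtain ⟨g, hg⟩ := Triangle.yoneda_exact₂ _ (F.triangle j) f h0
    have := σ.hom_eq_zero _ _ _ _ (hF j (by simp [Fin.lt_def])) (F.factor_mem j) hy g
    exact hg.trans ((congrArg (_ ≫ ·) this).trans comp_zero)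

variable {σ}

/-- Since `F_0 = 0`, the identity of the first factor lifts to `F_1`. If its phase exceeded `φ`, it
would have no nonzero maps to `x`, hence none to `F_1`, and would vanish. -/
lemma phase_zero_le {x : C} {φ : ℝ} (hx : σ.P φ x) (F : HNFiltration σ.P x) (h : 0 < F.n) :
    F.phase ⟨0, h⟩ ≤ φ := by
  by_contra! hlt
  set i : Fin F.n := ⟨0, h⟩
  have hle : ∀ j, F.phase j ≤ F.phase i := fun j =>
    F.phase_strictAnti.antitone (Fin.le_def.2 (Nat.zero_le _))
  have hz := σ.hom_obj_eq_zero F (F.factor_mem i) (fun j => by linarith [hle j])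
    (σ.hom_eq_zero _ _ _ _ hlt (F.factor_mem i) hx) i.succ
  have hbot : IsZero (F.obj i.castSucc) := F.isZero_bot
  obtain ⟨g, hg⟩ := Triangle.coyoneda_exact₃ _ (F.triangle i) (𝟙 (F.factor i))
    (((shiftFunctor C (1 : ℤ)).map_isZero hbot).eq_of_tgt _ _)
  refine F.factor_nonzero i ((IsZero.iff_id_eq_zero _).2 ?_)
  exact hg.trans ((congrArg (· ≫ _) (hz g)).trans zero_comp)

/-- If the last phase were below `φ`, the projection from `x` to the last factor `b` would vanish,
so the identity of `b` would factor through `F_{n-1}[1]`. But `F_{n-1}` has no nonzero maps to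
`b[-1]`. -/
lemma le_phase_last {x : C} {φ : ℝ} (hx : σ.P φ x) (F : HNFiltration σ.P x) (i : Fin F.n)
    (hi : i.succ = Fin.last F.n) : φ ≤ F.phase i := by
  by_contra! hlt
  have hproj : F.proj i = 0 := by
    have e : F.obj i.succ ≅ x := eqToIso (by rw [hi]) ≪≫ F.topIso
    exact σ.hom_eq_zero _ _ _ _ hlt (σ.mem_of_iso _ _ _ e.symm hx) (F.factor_mem i) _
  obtain ⟨g, hg⟩ := Triangle.yoneda_exact₃ _ (F.triangle i) (𝟙 (F.factor i))
    ((Category.comp_id _).trans hproj)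
  have hg0 : g = 0 := by
    let e := (shiftNegShift (F.factor i) (1 : ℤ))
    obtain ⟨g', hg'⟩ := (shiftFunctor C (1 : ℤ)).map_surjective (g ≫ e.inv)
    have : g' = 0 := σ.obj_hom_eq_zero F (σ.P_shift_neg (F.factor_mem i)) i.castSucc
      (fun j hj => by
        have : F.phase i < F.phase j := F.phase_strictAnti (by simpa using hj)
        linarith) g'
    rw [this, Functor.map_zero] at hg'
    rw [← cancel_mono e.inv, ← hg', zero_comp]
  refine F.factor_nonzero i ((IsZero.iff_id_eq_zero _).2 ?_)
  exact hg.trans ((congrArg (_ ≫ ·) hg0).trans comp_zero)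

lemma n_eq_one {x : C} {φ : ℝ} (hx : σ.P φ x) (hx0 : ¬ IsZero x) (F : HNFiltration σ.P x) :
    F.n = 1 := by
  have h := F.n_pos hx0
  have h1 := phase_zero_le hx F h
  have h2 := le_phase_last hx F ⟨F.n - 1, by omega⟩ (by ext; simp; omega)
  by_contra hne
  have : F.phase ⟨F.n - 1, by omega⟩ < F.phase ⟨0, h⟩ :=
    F.phase_strictAnti (Fin.lt_def.2 (by simp; omega))
  linarith

lemma phase_eq {x : C} {φ : ℝ} (hx : σ.P φ x) (hx0 : ¬ IsZero x) (F : HNFiltration σ.P x)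
    (i : Fin F.n) : F.phase i = φ := by
  have hn := n_eq_one hx hx0 F
  have hi : i = ⟨0, F.n_pos hx0⟩ := by ext; simp; omega
  refine le_antisymm ?_ (le_phase_last hx F i (by ext; simp; omega))
  rw [hi]
  exact phase_zero_le hx F _

lemma phiPlus_eq {x : C} {φ : ℝ} (hx : σ.P φ x) (hx0 : ¬ IsZero x) : σ.phiPlus x hx0 = φ :=
  phase_eq hx hx0 _ _

lemma phiMinus_eq {x : C} {φ : ℝ} (hx : σ.P φ x) (hx0 : ¬ IsZero x) : σ.phiMinus x hx0 = φ :=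
  phase_eq hx hx0 _ _

lemma mass_eq {x : C} {φ : ℝ} (hx : σ.P φ x) (hx0 : ¬ IsZero x) :
    σ.mass x hx0 = ‖σ.Z (cls x)‖ := by
  have hn := n_eq_one hx hx0 (σ.hn x hx0)
  have : Unique (Fin (σ.hn x hx0).n) := ⟨⟨⟨0, by omega⟩⟩, fun i => by ext; simp; omega⟩
  rw [mass, (σ.hn x hx0).cls_eq_sum, Fintype.sum_unique, Fintype.sum_unique]

lemma norm_Z_le_mass (x : C) (hx : ¬ IsZero x) : ‖σ.Z (cls x)‖ ≤ σ.mass x hx := by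
  rw [(σ.hn x hx).cls_eq_sum, map_sum]
  exact norm_sum_le _ _

lemma mass_factor_le (x : C) (hx : ¬ IsZero x) (i : Fin (σ.hn x hx).n) :
    σ.mass _ ((σ.hn x hx).factor_nonzero i) ≤ σ.mass x hx := by
  rw [mass_eq ((σ.hn x hx).factor_mem i)]
  exact Finset.single_le_sum (f := fun i => ‖σ.Z (cls ((σ.hn x hx).factor i))‖)
    (fun _ _ => norm_nonneg _) (Finset.mem_univ i)

lemma distAt_lt {τ : StabilityCondition C} {d : ℝ} (h : edist σ τ < ENNReal.ofReal d)
    (c : C) (hc : ¬ IsZero c) : distAt σ τ c hc < d := by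
  have h1 : ENNReal.ofReal (distAt σ τ c hc) ≤ edist σ τ :=
    le_iSup₂ (f := fun c hc => ENNReal.ofReal (distAt σ τ c hc)) c hc
  exact (ENNReal.ofReal_lt_ofReal_iff_of_nonneg
    ((abs_nonneg _).trans (le_max_right _ _))).1 (h1.trans_lt h)

lemma mass_le_of_edist_lt {τ : StabilityCondition C} {d : ℝ}
    (h : edist σ τ < ENNReal.ofReal d) (c : C) (hc : ¬ IsZero c) :
    σ.mass c hc ≤ Real.exp d * τ.mass c hc := by
  have h1 := (le_abs_self _).trans ((le_max_right _ _).trans (distAt_lt h c hc).le)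
  rwa [Real.log_le_iff_le_exp (div_pos (σ.mass_pos c hc) (τ.mass_pos c hc)),
    div_le_iff₀ (τ.mass_pos c hc)] at h1

lemma abs_phiPlus_sub_lt {τ : StabilityCondition C} {d : ℝ}
    (h : edist σ τ < ENNReal.ofReal d) (c : C) (hc : ¬ IsZero c) :
    |σ.phiPlus c hc - τ.phiPlus c hc| < d :=
  ((le_max_right _ _).trans (le_max_left _ _)).trans_lt (distAt_lt h c hc)

lemma abs_phiMinus_sub_lt {τ : StabilityCondition C} {d : ℝ}
    (h : edist σ τ < ENNReal.ofReal d) (c : C) (hc : ¬ IsZero c) :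
    |σ.phiMinus c hc - τ.phiMinus c hc| < d :=
  ((le_max_left _ _).trans (le_max_left _ _)).trans_lt (distAt_lt h c hc)

end StabilityCondition

/-! ### Merging factors of a filtration -/

/-- There is an exact triangle `a → b → x → a[1]`. -/
def IsExtension (a b x : C) : Prop :=
  ∃ (f : a ⟶ b) (g : b ⟶ x) (w : x ⟶ a⟦(1 : ℤ)⟧), Triangle.mk f g w ∈ distTriang C

/-- `WeakFiltration P s c`: the object `c` has a filtration with factors in the `P θ` for strictly
decreasing phases `θ`, the last of which is `s`, or `c` is zero. -/
inductive WeakFiltration (P : ℝ → ObjectProperty C) : ℝ → C → Prop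
  | zero (s : ℝ) (c : C) : IsZero c → WeakFiltration P s c
  | step (s t : ℝ) (T : Triangle C) : T ∈ distTriang C → WeakFiltration P t T.obj₁ → s < t →
      P s T.obj₃ → ¬ IsZero T.obj₃ → WeakFiltration P s T.obj₂

namespace WeakFiltration

variable {P : ℝ → ObjectProperty C}

lemma of_iso {s : ℝ} {c d : C} (h : WeakFiltration P s c) (e : c ≅ d) :
    WeakFiltration P s d := by
  cases h with
  | zero _ _ h => exact zero _ _ (h.of_iso e.symm)
  | step _ t T hT h1 hst h3 h3' =>
    exact step s t (Triangle.mk (T.mor₁ ≫ e.hom) (e.inv ≫ T.mor₂) T.mor₃)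
      (isomorphic_distinguished _ hT _
        (Triangle.isoMk _ _ (Iso.refl _) e.symm (Iso.refl _)
          (by change (T.mor₁ ≫ e.hom) ≫ e.inv = 𝟙 T.obj₁ ≫ T.mor₁; simp)
          (by change (e.inv ≫ T.mor₂) ≫ 𝟙 T.obj₃ = e.inv ≫ T.mor₂; simp)
          (by change T.mor₃ ≫ (𝟙 T.obj₁)⟦(1 : ℤ)⟧' = 𝟙 T.obj₃ ≫ T.mor₃; simp))) h1 hst h3 h3'

/-- Appending a factor whose phase is at most the last phase. -/
lemma append [IsTriangulated C]
    (hext : ∀ (s : ℝ) (T : Triangle C), T ∈ distTriang C → P s T.obj₁ → P s T.obj₃ → P s T.obj₂)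
    {s s' : ℝ} (hs : s' ≤ s) {T : Triangle C} (hT : T ∈ distTriang C)
    (h : WeakFiltration P s T.obj₁) (hb : P s' T.obj₃) (hb0 : ¬ IsZero T.obj₃) :
    ∃ s'', s' ≤ s'' ∧ WeakFiltration P s'' T.obj₂ := by
  obtain ⟨a, c, b, f, g, w⟩ := T
  dsimp only at h hb hb0 ⊢
  rcases hs.lt_or_eq with hlt | rfl
  · exact ⟨s', le_rfl, step s' s (Triangle.mk f g w) hT h hlt hb hb0⟩
  cases h with
  | zero _ _ h => exact ⟨s', le_rfl, step s' (s' + 1) (Triangle.mk f g w) hT (zero _ _ h)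
      (by linarith) hb hb0⟩
  | step _ t T' hT' h1 hst h3 h3' =>
    obtain ⟨a', c', b', f', g', w'⟩ := T'
    dsimp only at h1 h3 h3' f w hT ⊢
    obtain ⟨x, v, u, hx⟩ := distinguished_cocone_triangle (f' ≫ f)
    -- The octahedron exhibits the cone `x` of `a' ⟶ c` as an extension of `b` by `b'`; it replaces
    -- these two factors of equal phase.
    have o := Triangulated.someOctahedron rfl hT' hT hx
    have hPx : P s' x := hext s' _ o.mem h3 hb
    -- If the two factors cancel, `c ≅ a'` ends at the larger phase `t`; hence only `s' ≤ s''` is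
    -- claimed.
    by_cases hx0 : IsZero x
    · have : IsIso (f' ≫ f) := (Triangle.isZero₃_iff_isIso₁ _ hx).1 hx0
      exact ⟨t, hst.le, h1.of_iso (asIso (f' ≫ f))⟩
    · exact ⟨s', le_rfl, step s' t (Triangle.mk (f' ≫ f) v u) hx h1 hst hPx hx0⟩

/-- Indexing by `ℕ` avoids transport between `Fin` types; values beyond the range are irrelevant.
The bound `s ≤ phase i` carries strict monotonicity through the induction. -/
lemma exists_sequence {s : ℝ} {c : C} (h : WeakFiltration P s c) :
    ∃ (n : ℕ) (obj factor : ℕ → C) (phase : ℕ → ℝ), IsZero (obj 0) ∧ obj n = c ∧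
      (∀ i < n, IsExtension (obj i) (obj (i + 1)) (factor i)) ∧
      (∀ i < n, P (phase i) (factor i) ∧ ¬ IsZero (factor i) ∧ s ≤ phase i) ∧
      ∀ i j, i < j → j < n → phase j < phase i := by
  induction h with
  | zero s c h => exact ⟨0, fun _ => c, fun _ => c, fun _ => 0, h, rfl, by simp, by simp, by simp⟩
  | step s t T hT h1 hst h3 h3' ih =>
    obtain ⟨n, obj, factor, phase, hz, hn, htri, hfac, hanti⟩ := ih
    refine ⟨n + 1, fun i => if i ≤ n then obj i else T.obj₂,
      fun i => if i < n then factor i else T.obj₃, fun i => if i < n then phase i else s,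
      by simpa using hz, by simp, ?_, ?_, ?_⟩
    · intro i hi
      rcases (Nat.lt_succ_iff.1 hi).lt_or_eq with hlt | rfl
      · simpa [hlt, hlt.le, Nat.succ_le_of_lt hlt] using htri i hlt
      · simp only [le_refl, if_true, lt_irrefl, if_false, Nat.not_succ_le_self, hn]
        exact ⟨T.mor₁, T.mor₂, T.mor₃, hT⟩
    · intro i hi
      rcases (Nat.lt_succ_iff.1 hi).lt_or_eq with hlt | rfl
      · have := hfac i hlt
        simp only [hlt, if_true]
        exact ⟨this.1, this.2.1, hst.le.trans this.2.2⟩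
      · simpa using ⟨h3, h3'⟩
    · intro i j hij hj
      have hi : i < n := by omega
      rcases (Nat.lt_succ_iff.1 hj).lt_or_eq with hlt | rfl
      · simpa [hi, hlt] using hanti i j hij hlt
      · simpa [hi] using hst.trans_le (hfac i hi).2.2

lemma nonempty_hnFiltration {s : ℝ} {c : C} (h : WeakFiltration P s c) :
    Nonempty (HNFiltration P c) := by
  obtain ⟨n, obj, factor, phase, hz, hn, htri, hfac, hanti⟩ := h.exists_sequence
  choose f g w hT using htri
  exact ⟨{
    n := n
    obj := fun i => obj i
    map := fun i => f i i.2
    factor := fun i => factor i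
    proj := fun i => g i i.2
    conn := fun i => w i i.2
    triangle := fun i => hT i i.2
    isZero_bot := hz
    topIso := eqToIso hn
    phase := fun i => phase i
    phase_strictAnti := fun i j hij => hanti i j hij j.2
    factor_mem := fun i => (hfac i i.2).1
    factor_nonzero := fun i => (hfac i i.2).2.1 }⟩

end WeakFiltration

/-- A filtration can be regrouped along a weakly decreasing change of phases, when the target
subcategories are extension closed. -/
lemma HNFiltration.regroup [IsTriangulated C] {P Q : ℝ → ObjectProperty C} {c : C}
    (F : HNFiltration P c)
    (hext : ∀ (s : ℝ) (T : Triangle C), T ∈ distTriang C → Q s T.obj₁ → Q s T.obj₃ → Q s T.obj₂)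
    (θ : Fin F.n → ℝ) (hθ : Antitone θ) (hQ : ∀ i, Q (θ i) (F.factor i)) :
    Nonempty (HNFiltration Q c) := by
  -- The last phase so far must dominate every phase still to be appended. At the zero object it is
  -- arbitrary, so `∑ j, |θ j|` serves.
  have key : ∀ k : Fin (F.n + 1), ∃ s, (∀ j : Fin F.n, k ≤ j.castSucc → θ j ≤ s) ∧
      WeakFiltration Q s (F.obj k) := by
    intro k
    induction k using Fin.induction with
    | zero =>
      exact ⟨∑ j, |θ j|, fun j _ => (le_abs_self _).trans
        (Finset.single_le_sum (f := fun j => |θ j|) (fun _ _ => abs_nonneg _)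
          (Finset.mem_univ j)), .zero _ _ F.isZero_bot⟩
    | succ i ih =>
      obtain ⟨s, hs, h⟩ := ih
      obtain ⟨s'', hs'', h''⟩ := WeakFiltration.append hext (hs i le_rfl) (F.triangle i) h (hQ i)
        (F.factor_nonzero i)
      refine ⟨s'', fun j hj => (hθ ?_).trans hs'', h''⟩
      simp only [Fin.le_def] at hj ⊢
      simp at hj
      omega
  obtain ⟨s, -, h⟩ := key (Fin.last _)
  exact (h.of_iso F.topIso).nonempty_hnFiltration

end Triangulated

/-! ### Finiteness in `A` and separation of phases -/

/-- A subset of a finitely generated abelian group on which every homomorphism to `ℂ` is bounded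
is finite. -/
lemma finite_of_forall_hom_bounded {A : Type*} [AddCommGroup A] [AddGroup.FG A] (S : Set A)
    (hS : ∀ V : A →+ ℂ, ∃ K : ℝ, ∀ a ∈ S, ‖V a‖ ≤ K) : S.Finite := by
  obtain ⟨n, ι, _, p, hp, e, ⟨f⟩⟩ := AddCommGroup.equiv_free_prod_directSum_zmod A
  have hne : ∀ i, NeZero (p i ^ e i) := fun i => ⟨pow_ne_zero _ (hp i).ne_zero⟩
  classical
  have : Finite (DirectSum ι fun i => ZMod (p i ^ e i)) :=
    Finite.of_equiv _ (DirectSum.addEquivProd fun i => ZMod (p i ^ e i)).symm.toEquiv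
  let coord (j : Fin n) : A →+ ℂ := (Int.castAddHom ℂ).comp
    ((Finsupp.applyAddHom j).comp ((AddMonoidHom.fst _ _).comp f.toAddMonoidHom))
  choose K hK using fun j => hS (coord j)
  have hfin : (Set.univ.pi fun j => Set.Icc (-⌈K j⌉) ⌈K j⌉ : Set (Fin n → ℤ)).Finite :=
    Set.Finite.pi fun j => Set.finite_Icc _ _
  let g : A → (Fin n → ℤ) × (DirectSum ι fun i => ZMod (p i ^ e i)) :=
    fun a => (fun j => (f a).1 j, (f a).2)
  have hg : Function.Injective g := fun a b hab => by
    simp only [g, Prod.mk.injEq] at hab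
    exact f.injective (Prod.ext (DFunLike.coe_injective hab.1) hab.2)
  refine ((hfin.prod (Set.finite_univ)).preimage hg.injOn).subset fun a ha => ?_
  refine ⟨fun j _ => ?_, trivial⟩
  have h : ‖(((f a).1 j : ℤ) : ℂ)‖ ≤ K j := hK j a ha
  rw [Complex.norm_intCast, ← Int.cast_abs] at h
  exact abs_le.1 (Int.cast_le.1 (h.trans (Int.le_ceil _)))

lemma norm_exp_I_pi_sub_le (a b : ℝ) :
    ‖Complex.exp (Complex.I * Real.pi * a) - Complex.exp (Complex.I * Real.pi * b)‖
      ≤ Real.pi * |a - b| := by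
  have h1 : Complex.exp (Complex.I * Real.pi * a) - Complex.exp (Complex.I * Real.pi * b)
      = Complex.exp ((Real.pi * b : ℝ) * Complex.I)
        * (Complex.exp (Complex.I * (Real.pi * (a - b) : ℝ)) - 1) := by
    rw [mul_sub, ← Complex.exp_add, mul_one]
    congr 2 <;> push_cast <;> ring
  rw [h1, norm_mul, Complex.norm_exp_ofReal_mul_I, one_mul]
  refine (Real.norm_exp_I_mul_ofReal_sub_one_le).trans ?_
  rw [Real.norm_eq_abs, abs_mul, abs_of_pos Real.pi_pos]

/-- Phases whose directions lie in a given finite set are uniformly separated. -/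
lemma exists_phase_gap {S : Set ℂ} (hS : S.Finite) :
    ∃ δ : ℝ, 0 < δ ∧ ∀ θ θ' : ℝ, Complex.exp (Complex.I * Real.pi * θ) ∈ S →
      Complex.exp (Complex.I * Real.pi * θ') ∈ S → |θ - θ'| < δ → θ = θ' := by
  obtain ⟨ε, hε, hsep⟩ : ∃ ε : ℝ, 0 < ε ∧ ∀ x ∈ S, ∀ y ∈ S, x ≠ y → ε ≤ ‖x - y‖ := by
    have hfin : ((fun z : ℂ × ℂ => ‖z.1 - z.2‖) '' ((S ×ˢ S) \ {z | z.1 = z.2})).Finite :=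
      ((hS.prod hS).subset Set.sdiff_subset).image _
    by_cases hne : ((S ×ˢ S) \ {z : ℂ × ℂ | z.1 = z.2}).Nonempty
    · obtain ⟨r, ⟨z, hz, rfl⟩, hr⟩ := Set.exists_min_image _ id hfin (hne.image _)
      exact ⟨_, norm_pos_iff.2 (sub_ne_zero.2 hz.2), fun x hx y hy hxy =>
        hr _ ⟨(x, y), ⟨⟨hx, hy⟩, hxy⟩, rfl⟩⟩
    · exact ⟨1, one_pos, fun x hx y hy hxy => absurd ⟨(x, y), ⟨hx, hy⟩, hxy⟩ hne⟩
  -- `ε / π` forces equal directions, as the exponential is `π`-Lipschitz in the phase; `2` is its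
  -- period.
  refine ⟨min 2 (ε / Real.pi), by positivity, fun θ θ' h h' hlt => ?_⟩
  have heq : Complex.exp (Complex.I * Real.pi * θ) = Complex.exp (Complex.I * Real.pi * θ') := by
    by_contra hne
    have h1 := (hsep _ h _ h' hne).trans (norm_exp_I_pi_sub_le θ θ')
    have h2 := (lt_div_iff₀ Real.pi_pos).1 (hlt.trans_le (min_le_right _ _))
    linarith
  obtain ⟨k, hk⟩ := Complex.exp_eq_exp_iff_exists_int.1 heq
  have hk' : θ = θ' + 2 * k := by
    have h0 : (Complex.I * Real.pi : ℂ) ≠ 0 :=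
      mul_ne_zero Complex.I_ne_zero (by exact_mod_cast Real.pi_ne_zero)
    have : (θ : ℂ) = θ' + 2 * k := mul_left_cancel₀ h0 (by rw [hk]; ring)
    exact_mod_cast this
  have hlt2 : |(2 * k : ℝ)| < 2 := by
    have := hlt.trans_le (min_le_left _ _)
    rwa [hk', add_sub_cancel_left] at this
  have hk0 : k = 0 := by
    rw [abs_mul, abs_two, ← Int.cast_abs] at hlt2
    have : ((|k| : ℤ) : ℝ) < 1 := by linarith
    exact Int.abs_lt_one_iff.1 (by exact_mod_cast this)
  simpa [hk0] using hk'

/-! ### Support property and limits of phases -/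

section Triangulated

variable {C : Type*} [Category C] [Preadditive C] [HasZeroObject C] [HasShift C ℤ]
  [∀ n : ℤ, (shiftFunctor C n).Additive] [Pretriangulated C]
  {A : Type*} [AddCommGroup A] {q : K C →+ A}

namespace StabilityCondition

lemma Z_eq_norm_mul {σ : StabilityCondition C} {φ : ℝ} {c : C} (h : σ.P φ c) (hc : ¬ IsZero c) :
    σ.Z (cls c) = ‖σ.Z (cls c)‖ * Complex.exp (Complex.I * Real.pi * φ) := by
  obtain ⟨m, hm, h⟩ := σ.charge φ c h hc
  have h1 : ‖Complex.exp (Complex.I * Real.pi * φ)‖ = 1 := by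
    rw [mul_assoc, mul_comm, ← Complex.ofReal_mul, Complex.norm_exp_ofReal_mul_I]
  rw [h, norm_mul, h1, mul_one, Complex.norm_real, Real.norm_of_nonneg hm.le]

/-- The support property of the stability conditions in a full component. -/
lemma exists_norm_le_mass {U : Set (StabilityCondition C)} {π : U → (A →+ ℂ)}
    (hZ : ∀ σ : U, σ.1.Z = (π σ).comp q)
    (hπ : @IsLocalHomeomorph U (A →+ ℂ) inferInstance (homTopology A) π)
    (τ : U) (V : A →+ ℂ) :
    ∃ B : ℝ, ∀ (c : C) (hc : ¬ IsZero c), ‖V (q (cls c))‖ ≤ B * τ.1.mass c hc := by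
  let := homTopology A
  have hball : {σ : U | edist σ.1 τ.1 < ENNReal.ofReal 1} ∈ 𝓝 τ :=
    continuous_subtype_val.continuousAt.preimage_mem_nhds
      (Metric.eball_mem_nhds τ.1 (by simp))
  have himg : π '' {σ : U | edist σ.1 τ.1 < ENNReal.ofReal 1} ∈ 𝓝 (π τ) := by
    rw [← hπ.map_nhds_eq τ]
    exact image_mem_map hball
  -- For small `t > 0` the charge `π τ + t V` is realised by some `ρ` within distance `1` of `τ`.
  -- Then `t V` is a difference of two charges, each bounded by a mass.
  let ℓ : ℝ → (A →+ ℂ) := fun t => π τ + (AddMonoidHom.mulLeft (t : ℂ)).comp V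
  have hℓ : Continuous ℓ := by
    rw [continuous_induced_rng]
    refine continuous_pi fun a => ?_
    change Continuous fun t : ℝ => π τ a + (t : ℂ) * V a
    fun_prop
  have hℓ0 : ℓ 0 = π τ := by
    ext a
    simp [ℓ]
  have hev : ∀ᶠ t in 𝓝 (0 : ℝ), ℓ t ∈ π '' {σ : U | edist σ.1 τ.1 < ENNReal.ofReal 1} := by
    refine hℓ.continuousAt.eventually_mem ?_
    rwa [hℓ0]
  obtain ⟨t, ⟨ρ, hρ, hρt⟩, ht⟩ :=
    ((hev.filter_mono nhdsWithin_le_nhds).and (self_mem_nhdsWithin (a := (0 : ℝ))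
      (s := Set.Ioi 0))).exists
  have ht : 0 < t := ht
  refine ⟨(Real.exp 1 + 1) / t, fun c hc => ?_⟩
  have h1 : (t : ℂ) * V (q (cls c)) = ρ.1.Z (cls c) - τ.1.Z (cls c) := by
    rw [hZ, hZ, hρt]
    simp [ℓ]
  have h2 : t * ‖V (q (cls c))‖ ≤ (Real.exp 1 + 1) * τ.1.mass c hc := by
    have h3 : t * ‖V (q (cls c))‖ = ‖(t : ℂ) * V (q (cls c))‖ := by
      rw [norm_mul, Complex.norm_real, Real.norm_of_nonneg ht.le]
    rw [h3, h1, add_mul, one_mul]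
    exact (norm_sub_le _ _).trans (add_le_add ((norm_Z_le_mass c hc).trans
      (mass_le_of_edist_lt hρ c hc)) (norm_Z_le_mass c hc))
  rw [div_mul_eq_mul_div, le_div_iff₀ ht, mul_comm]
  exact h2

/-- The classes of the objects of mass at most `M`. -/
def boundedClasses (q : K C →+ A) (τ : StabilityCondition C) (M : ℝ) : Set A :=
  {a | ∃ (c : C) (hc : ¬ IsZero c), τ.mass c hc ≤ M ∧ q (cls c) = a}

lemma finite_boundedClasses [AddGroup.FG A] {U : Set (StabilityCondition C)}
    {π : U → (A →+ ℂ)} (hZ : ∀ σ : U, σ.1.Z = (π σ).comp q)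
    (hπ : @IsLocalHomeomorph U (A →+ ℂ) inferInstance (homTopology A) π)
    (τ : U) (M : ℝ) : (boundedClasses q τ.1 M).Finite := by
  refine finite_of_forall_hom_bounded _ fun V => ?_
  obtain ⟨B, hB⟩ := exists_norm_le_mass hZ hπ τ V
  refine ⟨|B| * M, ?_⟩
  rintro _ ⟨c, hc, hM, rfl⟩
  exact (hB c hc).trans (mul_le_mul (le_abs_self B) hM (τ.1.mass_pos c hc).le (abs_nonneg B))

/-- An object of mass at most `1` has a semistable factor of mass at most `1`, and that mass is one
of finitely many nonzero values `‖W a‖`. -/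
lemma exists_mass_lower_bound {τ : StabilityCondition C} {W : A →+ ℂ} (hW : τ.Z = W.comp q)
    (hfin : (boundedClasses q τ 1).Finite) :
    ∃ μ : ℝ, 0 < μ ∧ ∀ (c : C) (hc : ¬ IsZero c), μ ≤ τ.mass c hc := by
  obtain ⟨μ, hμ, hmin⟩ : ∃ μ : ℝ, 0 < μ ∧ ∀ a ∈ boundedClasses q τ 1, W a ≠ 0 → μ ≤ ‖W a‖ := by
    have hfin' : (boundedClasses q τ 1 \ {a | W a = 0}).Finite := hfin.subset Set.sdiff_subset
    by_cases hne : (boundedClasses q τ 1 \ {a | W a = 0}).Nonempty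
    · obtain ⟨a, ha, hr⟩ := Set.exists_min_image _ (fun a => ‖W a‖) hfin' hne
      exact ⟨_, norm_pos_iff.2 ha.2, fun b hb hb0 => hr b ⟨hb, hb0⟩⟩
    · exact ⟨1, one_pos, fun b hb hb0 => absurd ⟨b, hb, hb0⟩ hne⟩
  refine ⟨min 1 μ, by positivity, fun c hc => ?_⟩
  rcases le_total 1 (τ.mass c hc) with h1 | h1
  · exact (min_le_left _ _).trans h1
  · let i : Fin (τ.hn c hc).n := ⟨0, (τ.hn c hc).n_pos hc⟩
    have hle := mass_factor_le c hc i
    have heq := mass_eq ((τ.hn c hc).factor_mem i) ((τ.hn c hc).factor_nonzero i)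
    have hpos := τ.mass_pos _ ((τ.hn c hc).factor_nonzero i)
    have hZ : τ.Z (cls ((τ.hn c hc).factor i)) = W (q (cls ((τ.hn c hc).factor i))) := by
      rw [hW]; rfl
    rw [heq, hZ] at hle hpos
    exact (min_le_right _ _).trans ((hmin _ ⟨_, (τ.hn c hc).factor_nonzero i, by
      rw [heq, hZ]; exact hle.trans h1, rfl⟩ (norm_pos_iff.1 hpos)).trans hle)

/-- Passing from `τ` to `σ` and back costs a factor `e` each way. -/
lemma mass_factor_le_of_edist_lt {σ τ : StabilityCondition C}
    (h : edist σ τ < ENNReal.ofReal 1) {c : C} (hc : ¬ IsZero c) {M : ℝ}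
    (hM : τ.mass c hc ≤ M) (i : Fin (σ.hn c hc).n) :
    τ.mass _ ((σ.hn c hc).factor_nonzero i) ≤ Real.exp 1 * (Real.exp 1 * M) := by
  have h' : edist τ σ < ENNReal.ofReal 1 := by rwa [edist_comm]
  refine (mass_le_of_edist_lt h' _ _).trans (mul_le_mul_of_nonneg_left ?_ (Real.exp_pos _).le)
  exact (mass_factor_le c hc i).trans ((mass_le_of_edist_lt h c hc).trans
    (mul_le_mul_of_nonneg_left hM (Real.exp_pos _).le))

/-- The directions of the limits of the phases of semistable objects of bounded mass form a finite
set. -/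
lemma exists_finite_directions {τ : StabilityCondition C} {σ : ℕ → StabilityCondition C}
    {W : ℕ → (A →+ ℂ)} (hW : ∀ n, (σ n).Z = (W n).comp q)
    (hd : ∀ᶠ n in atTop, edist (σ n) τ < ENNReal.ofReal 1)
    {μ : ℝ} (hμ : 0 < μ) (hmass : ∀ (c : C) (hc : ¬ IsZero c), μ ≤ τ.mass c hc)
    {M : ℝ} (hfin : (boundedClasses q τ M).Finite) :
    ∃ S : Set ℂ, S.Finite ∧ ∀ (x : ℕ → C) (φ : ℕ → ℝ) (θ : ℝ),
      (∀ᶠ n in atTop, (σ n).P (φ n) (x n) ∧ ∃ h : ¬ IsZero (x n), τ.mass (x n) h ≤ M) →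
      Tendsto φ atTop (𝓝 θ) → Complex.exp (Complex.I * Real.pi * θ) ∈ S := by
  -- The ultrafilter is fixed before the sequence `x`, so the limits `L a`, and with them `S`, do
  -- not depend on `x`. Along it bounded charges converge and a class from a finite set is
  -- eventually constant.
  let 𝒰 : Ultrafilter ℕ := hyperfilter ℕ
  have h𝒰 : (𝒰 : Filter ℕ) ≤ atTop := Nat.hyperfilter_le_atTop
  have hlim : ∀ a : boundedClasses q τ M, ∃ l : ℂ, Tendsto (fun n => W n a) 𝒰 (𝓝 l) := by
    rintro ⟨_, c, hc, -, rfl⟩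
    have hb : ∀ᶠ n in 𝒰, W n (q (cls c)) ∈
        Metric.closedBall (0 : ℂ) (Real.exp 1 * τ.mass c hc) := by
      filter_upwards [h𝒰 hd] with n hn
      rw [mem_closedBall_zero_iff]
      have : W n (q (cls c)) = (σ n).Z (cls c) := by rw [hW]; rfl
      rw [this]
      exact (norm_Z_le_mass c hc).trans (mass_le_of_edist_lt hn c hc)
    obtain ⟨l, -, hl⟩ := (isCompact_closedBall (0 : ℂ) _).ultrafilter_le_nhds
      (𝒰.map fun n => W n (q (cls c))) (le_principal_iff.2 hb)
    exact ⟨l, hl⟩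
  choose L hL using hlim
  have := hfin.to_subtype
  refine ⟨Set.range fun a => L a / (‖L a‖ : ℂ), Set.finite_range _, fun x φ θ hx hφ => ?_⟩
  have hmem : ∀ᶠ n in 𝒰, q (cls (x n)) ∈ boundedClasses q τ M := by
    filter_upwards [h𝒰 hx] with n hn
    exact ⟨x n, hn.2.1, hn.2.2, rfl⟩
  obtain ⟨a, ha, hpure⟩ := Ultrafilter.eq_pure_of_finite_mem
    (f := 𝒰.map fun n => q (cls (x n))) hfin hmem
  have hev : ∀ᶠ n in 𝒰, q (cls (x n)) = a := by
    have : ({a} : Set A) ∈ 𝒰.map fun n => q (cls (x n)) := by rw [hpure]; rfl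
    exact this
  -- The lower bound keeps `L a` away from zero, so its direction is defined.
  have hkey : ∀ᶠ n in 𝒰, Real.exp (-1) * μ ≤ ‖W n a‖ ∧
      W n a = ‖W n a‖ * Complex.exp (Complex.I * Real.pi * φ n) := by
    filter_upwards [hev, h𝒰 hx, h𝒰 hd] with n h1 h2 h3
    obtain ⟨hP, h0, -⟩ := h2
    have hZ : W n a = (σ n).Z (cls (x n)) := by rw [hW, ← h1]; rfl
    rw [hZ]
    refine ⟨?_, Z_eq_norm_mul hP h0⟩
    rw [← mass_eq hP h0, Real.exp_neg, inv_mul_le_iff₀ (Real.exp_pos _)]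
    rw [edist_comm] at h3
    exact (hmass _ h0).trans (mass_le_of_edist_lt h3 _ h0)
  have hLa := hL ⟨a, ha⟩
  have hpos : 0 < ‖L ⟨a, ha⟩‖ :=
    (by positivity : 0 < Real.exp (-1) * μ).trans_le
      (ge_of_tendsto hLa.norm (hkey.mono fun _ h => h.1))
  have hcont : Continuous fun r : ℝ => Complex.exp (Complex.I * Real.pi * r) := by fun_prop
  have hlim2 : Tendsto (fun n => W n a) 𝒰
      (𝓝 (‖L ⟨a, ha⟩‖ * Complex.exp (Complex.I * Real.pi * θ))) := by
    refine Tendsto.congr' (hkey.mono fun _ h => h.2.symm) ?_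
    exact ((Complex.continuous_ofReal.tendsto _).comp hLa.norm).mul
      ((hcont.tendsto θ).comp (hφ.mono_left h𝒰))
  refine ⟨⟨a, ha⟩, ?_⟩
  have hpos' : (‖L ⟨a, ha⟩‖ : ℂ) ≠ 0 := by exact_mod_cast hpos.ne'
  have heq := tendsto_nhds_unique hLa hlim2
  exact (div_eq_iff hpos').2 (heq.trans (mul_comm _ _))

/-- For a Cauchy sequence of stability conditions the extreme phases of an object converge. -/
lemma exists_tendsto_phases {σ : ℕ → StabilityCondition C} (hσ : CauchySeq σ) (c : C)
    (hc : ¬ IsZero c) :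
    (∃ θ, Tendsto (fun n => (σ n).phiPlus c hc) atTop (𝓝 θ)) ∧
      ∃ θ, Tendsto (fun n => (σ n).phiMinus c hc) atTop (𝓝 θ) := by
  constructor <;> refine cauchySeq_tendsto_of_complete (Metric.cauchySeq_iff.2 fun ε hε => ?_) <;>
    obtain ⟨N, hN⟩ := EMetric.cauchySeq_iff.1 hσ (ENNReal.ofReal ε) (by simpa using hε) <;>
    refine ⟨N, fun m hm n hn => ?_⟩
  · exact abs_phiPlus_sub_lt (hN m hm n hn) c hc
  · exact abs_phiMinus_sub_lt (hN m hm n hn) c hc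

end StabilityCondition

end Triangulated

end StabCond

/-! ### The limiting filtration -/

open StabCond StabCond.StabilityCondition
theorem proposition3p4 {C : Type*} [Category C] [Preadditive C] [HasZeroObject C]
    [HasShift C ℤ] [∀ n : ℤ, (shiftFunctor C n).Additive] [Pretriangulated C]
    [IsTriangulated C]
    {A : Type*} [AddCommGroup A] [AddGroup.FG A]
    (q : StabCond.K C →+ A) (hq : Function.Surjective q)
    (U : Set (StabCond.StabilityCondition C)) (hU : StabCond.IsFullComponent q U)
    (σ : ℕ → StabCond.StabilityCondition C) (hσU : ∀ n, σ n ∈ U) (hσ : CauchySeq σ)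
    (c : C) (hc : ¬ IsZero c) :
    Nonempty (StabCond.HNFiltration (StabCond.limitingSemistable σ) c) := by
  obtain ⟨-, π, hZ, hπ⟩ := hU
  obtain ⟨N, hN⟩ := EMetric.cauchySeq_iff.1 hσ (ENNReal.ofReal 1) (by simp)
  have hfin := finite_boundedClasses hZ hπ ⟨σ N, hσU N⟩
  obtain ⟨μ, hμ, hmass⟩ := exists_mass_lower_bound (hZ ⟨σ N, hσU N⟩) (hfin 1)
  set M := Real.exp 1 * (Real.exp 1 * (σ N).mass c hc)
  obtain ⟨S, hS, hdir⟩ := exists_finite_directions (fun n => hZ ⟨σ n, hσU n⟩)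
    (eventually_atTop.2 ⟨N, fun n hn => hN n hn N le_rfl⟩) hμ hmass
    -- `M` bounds the factors of `c`; the further `e ^ 2` covers the factors of those factors under
    -- later `σ m`.
    (hfin (Real.exp 1 * (Real.exp 1 * M)))
  obtain ⟨δ, hδ, hgap⟩ := exists_phase_gap hS
  obtain ⟨n₀, hn₀⟩ := EMetric.cauchySeq_iff.1 hσ (ENNReal.ofReal (δ / 4)) (by simpa using hδ)
  set n := max n₀ N
  set F := (σ n).hn c hc
  have key : ∀ i, ∃ θ : ℝ, Complex.exp (Complex.I * Real.pi * θ) ∈ S ∧ |θ - F.phase i| ≤ δ / 4 ∧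
      limitingSemistable σ θ (F.factor i) := by
    intro i
    have hb := F.factor_nonzero i
    have hbM : (σ N).mass _ hb ≤ M :=
      mass_factor_le_of_edist_lt (hN n (le_max_right _ _) N le_rfl) hc le_rfl i
    obtain ⟨⟨θ, hθ⟩, θ', hθ'⟩ := exists_tendsto_phases hσ _ hb
    have hclose : |θ - F.phase i| ≤ δ / 4 := by
      refine le_of_tendsto (hθ.sub_const _).abs (eventually_atTop.2 ⟨n₀, fun m hm => ?_⟩)
      have := abs_phiPlus_sub_lt (hn₀ m hm n (le_max_left _ _)) _ hb
      rw [phiPlus_eq (F.factor_mem i)] at this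
      exact this.le
    have hclose' : |θ' - F.phase i| ≤ δ / 4 := by
      refine le_of_tendsto (hθ'.sub_const _).abs (eventually_atTop.2 ⟨n₀, fun m hm => ?_⟩)
      have := abs_phiMinus_sub_lt (hn₀ m hm n (le_max_left _ _)) _ hb
      rw [phiMinus_eq (F.factor_mem i)] at this
      exact this.le
    -- `φ⁺` is the phase of the first `σ m`-factor, a semistable object of bounded mass; `φ⁻` is
    -- treated below with the last one.
    have hmem : Complex.exp (Complex.I * Real.pi * θ) ∈ S := by
      refine hdir (fun m => ((σ m).hn _ hb).factor ⟨0, ((σ m).hn _ hb).n_pos hb⟩) _ θ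
        (eventually_atTop.2 ⟨N, fun m hm => ?_⟩) hθ
      exact ⟨((σ m).hn _ hb).factor_mem _, ((σ m).hn _ hb).factor_nonzero _,
        mass_factor_le_of_edist_lt (hN m hm N le_rfl) hb hbM _⟩
    have hmem' : Complex.exp (Complex.I * Real.pi * θ') ∈ S := by
      refine hdir (fun m => ((σ m).hn _ hb).factor ⟨((σ m).hn _ hb).n - 1,
        Nat.sub_one_lt_of_lt (((σ m).hn _ hb).n_pos hb)⟩) _ θ' (eventually_atTop.2 ⟨N, fun m hm => ?_⟩) hθ'
      exact ⟨((σ m).hn _ hb).factor_mem _, ((σ m).hn _ hb).factor_nonzero _,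
        mass_factor_le_of_edist_lt (hN m hm N le_rfl) hb hbM _⟩
    have heq : θ = θ' := by
      refine hgap _ _ hmem hmem' ?_
      rw [abs_le] at hclose hclose'
      rw [abs_lt]
      constructor <;> linarith [hclose.1, hclose.2, hclose'.1, hclose'.2]
    subst heq
    exact ⟨θ, hmem, hclose, .of _ ⟨hb, hθ, hθ'⟩⟩
  choose θ hmem hclose hlim using key
  refine F.regroup (fun s T hT h1 h3 => .ext T hT h1 h3) θ (fun i j hij => ?_) hlim
  -- A reversed pair of limit phases would differ by at most `δ / 2`, hence be equal.
  by_contra! hlt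
  have h1 := abs_le.1 (hclose i)
  have h2 := abs_le.1 (hclose j)
  have h3 := F.phase_strictAnti.antitone hij
  refine hlt.ne (hgap _ _ (hmem i) (hmem j) ?_)
  rw [abs_lt]
  constructor <;> linarith [h1.1, h1.2, h2.1, h2.2]
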